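/- Let $n\ge 0$, $\mu\in\mathbb R^n$, let $\Sigma\in\mathbb R^{n\times n}$ be symmetric positive definite, $\delta>0$ and $\varepsilon\in(0,1/2)$. Equip $\mathbb R^n$ with the norm $\|v\|=\|\Sigma^{-1/2}v\|_2$, and let $\|x\|_*=\sup\{x^\top v:\|v\|\le 1\}$ be its dual norm (so $\|x\|_*=\|\Sigma^{1/2}x\|_2$). For probability distributions $Q,P$ on $\mathbb R^n$ let $d_W(Q,P)=\inf_\gamma \mathbb E_{(X_1,X_2)\sim\gamma}\|X_1-X_2\|\in[0,\infty]$, the infimum being over all couplings $\gamma$ of $Q$ and $P$; on $\mathbb R$ use the same definition with the norm $|\cdot|$. Let $\mathcal P$ be the set of all probability distributions $Q$ on $\mathbb R^n$ with $d_W(Q,\mathcal N(\mu,\Sigma))\le\delta$, and $\mathcal P_0$ the set of all probability distributions $Q$ on $\mathbb R$ with $d_W(Q,\mathcal N(0,1))\le\delta$. Define $$\mathcal Z=\Big\{(x,\ell,u)\in\mathbb R^n\times\mathbb R\times\mathbb R:\ \inf_{Q\in\mathcal P}Q[\ell\le x^\top\xi\le u]\ge 1-\varepsilon\Big\},\qquad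 \mathcal Z_0=\Big\{(\ell,u)\in\mathbb R^2:\ \inf_{Q\in\mathcal P_0}Q[\ell\le\xi\le u]\ge 1-\varepsilon\Big\},$$ $$\mathcal Z_1=\operatorname{cl}\big\{(\ell,u,s)\in\mathbb R^3:\ s>0,\ (\ell/s,u/s)\in\mathcal Z_0\big\},\qquad g_\varepsilon(\ell,u)=\int_0^\infty\big[\Phi(u-t)-\Phi(\ell+t)-(1-\varepsilon)\big]^+\,dt,$$ where $\xi$ denotes a random vector (variable) with distribution $Q$, $\Phi$ is the cumulative distribution function of $\mathcal N(0,1)$ and $[a]^+=\max\{a,0\}$. Then: 1. $\mathcal Z_0=\{(\ell,u)\in\mathbb R^2:\ \delta\le g_\varepsilon(\ell,u)\}$. 2. For all $x\in\mathbb R^n$ and $\ell,u\in\mathbb R$: $(x,\ell,u)\in\mathcal Z$ if and only if there is $s\ge\|x\|_*$ with $(\ell-x^\top\mu,\ u-x^\top\mu,\ s)\in\mathcal Z_1$. 3. Both $\mathcal Z_0$ and $\mathcal Z$ are convex and closed. -/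

import Mathlib

open MeasureTheory ProbabilityTheory Set Filter
open scoped ENNReal MatrixOrder

noncomputable section

namespace WassersteinCC

/-- `γ` is a coupling of `P₁` and `P₂`: its two marginals are `P₁` and `P₂`. -/
def IsCoupling {E : Type*} [MeasurableSpace E] (P₁ P₂ : Measure E) (γ : Measure (E × E)) : Prop :=
  γ.map Prod.fst = P₁ ∧ γ.map Prod.snd = P₂

/-- The (order one) Wasserstein distance whose transport cost is `N (x₁ - x₂)`, for a norm `N`.
It takes values in `[0, ∞]`; it is `∞` if every coupling has infinite expected cost. -/
def wassersteinDist {E : Type*} [MeasurableSpace E] [AddCommGroup E] (N : E → ℝ)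
    (P₁ P₂ : Measure E) : ℝ≥0∞ :=
  ⨅ γ ∈ {γ : Measure (E × E) | IsCoupling P₁ P₂ γ}, ∫⁻ p, ENNReal.ofReal (N (p.1 - p.2)) ∂γ

/-- The Wasserstein ball of radius `δ` around `P`: all probability distributions `Q` with
`d_W(Q, P) ≤ δ`. -/
def wassersteinBall {E : Type*} [MeasurableSpace E] [AddCommGroup E] (N : E → ℝ)
    (P : Measure E) (δ : ℝ) : Set (Measure E) :=
  {Q | IsProbabilityMeasure Q ∧ wassersteinDist N Q P ≤ ENNReal.ofReal δ}

/-- The norm `‖·‖_*` dual to a norm `N` on `ℝⁿ`, `‖x‖_* = sup {xᵀ v : N v ≤ 1}`. -/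
def dualNorm {n : ℕ} (N : EuclideanSpace ℝ (Fin n) → ℝ) (x : EuclideanSpace ℝ (Fin n)) : ℝ :=
  sSup {r : ℝ | ∃ v, N v ≤ 1 ∧ r = inner ℝ x v}

/-- The ellipsoidal norm `‖S^{-1/2} v‖₂` of a positive definite matrix `S`, where `S^{1/2}` is the
positive semidefinite square root. -/
def ellipsoidalNorm {n : ℕ} (S : Matrix (Fin n) (Fin n) ℝ) (v : EuclideanSpace ℝ (Fin n)) : ℝ :=
  ‖Matrix.toEuclideanCLM (𝕜 := ℝ) (CFC.sqrt S)⁻¹ v‖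

/-- The feasible set `𝒵` of the two-sided distributionally robust chance constraint: all
`(x, ℓ, u)` with `inf_Q Q[ℓ ≤ xᵀξ ≤ u] ≥ 1 - ε`, where `Q` ranges over the Wasserstein ball of
radius `δ` around `𝒩(m, S)` for the ellipsoidal norm of `S`. -/
def feasibleSet {n : ℕ} (m : EuclideanSpace ℝ (Fin n)) (S : Matrix (Fin n) (Fin n) ℝ) (δ ε : ℝ) :
    Set (EuclideanSpace ℝ (Fin n) × ℝ × ℝ) :=
  {z | ENNReal.ofReal (1 - ε) ≤
    ⨅ Q ∈ wassersteinBall (ellipsoidalNorm S) (multivariateGaussian m S) δ,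
      Q {ξ | z.2.1 ≤ inner ℝ z.1 ξ ∧ inner ℝ z.1 ξ ≤ z.2.2}}

/-- The standardized set `𝒵₀`: all `(ℓ, u)` with `inf_Q Q[ℓ ≤ ξ ≤ u] ≥ 1 - ε`, where `Q` ranges
over the Wasserstein ball of radius `δ` around `𝒩(0, 1)` on the real line. -/
def standardSet (δ ε : ℝ) : Set (ℝ × ℝ) :=
  {z | ENNReal.ofReal (1 - ε) ≤
    ⨅ Q ∈ wassersteinBall (fun r : ℝ => |r|) (gaussianReal 0 1) δ,
      Q {ξ | z.1 ≤ ξ ∧ ξ ≤ z.2}}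

/-- The closed conic hull `𝒵₁` of `𝒵₀`. -/
def conicHull (δ ε : ℝ) : Set (ℝ × ℝ × ℝ) :=
  closure {z | 0 < z.2.2 ∧ (z.1 / z.2.2, z.2.1 / z.2.2) ∈ standardSet δ ε}

/-- The cumulative distribution function `Φ` of the standard Gaussian distribution. -/
def stdNormalCDF (r : ℝ) : ℝ := cdf (gaussianReal 0 1) r

/-- The integrand in the definition of `g_ε`. -/
def gIntegrand (ε ℓ u t : ℝ) : ℝ :=
  max (stdNormalCDF (u - t) - stdNormalCDF (ℓ + t) - (1 - ε)) 0

/-- `g_ε(ℓ, u) = ∫₀^∞ [Φ(u - t) - Φ(ℓ + t) - (1 - ε)]⁺ dt`. -/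
def gFun (ε ℓ u : ℝ) : ℝ := ∫ t in Ioi (0 : ℝ), gIntegrand ε ℓ u t

/-- The integral defining `g_ε` converges. -/
theorem integrableOn_gIntegrand {ε : ℝ} (hε : ε < 1) (ℓ u : ℝ) :
    IntegrableOn (gIntegrand ε ℓ u) (Ioi 0) := by
  have hm : Measurable (gIntegrand ε ℓ u) := by
    have hΦ : Measurable stdNormalCDF := (monotone_cdf (gaussianReal 0 1)).measurable
    unfold gIntegrand
    fun_prop
  have h1 : ∀ᶠ r in atBot, stdNormalCDF r < 1 - ε :=
    (tendsto_cdf_atBot (gaussianReal 0 1)).eventually_lt_const (by linarith)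
  obtain ⟨R, hR⟩ := eventually_atBot.1 h1
  have hz : ∀ t, u - R ≤ t → gIntegrand ε ℓ u t = 0 := fun t ht => by
    have h2 := hR (u - t) (by linarith)
    have h3 : 0 ≤ stdNormalCDF (ℓ + t) := cdf_nonneg _ _
    exact max_eq_right (by linarith)
  have hI : IntegrableOn (gIntegrand ε ℓ u) (Ioc 0 (u - R)) := by
    refine Measure.integrableOn_of_bounded (M := 1 + |1 - ε|) (by simp) hm.aestronglyMeasurable
      (ae_of_all _ fun t => ?_)
    have h3 : 0 ≤ stdNormalCDF (ℓ + t) := cdf_nonneg _ _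
    have h4 : stdNormalCDF (u - t) ≤ 1 := cdf_le_one _ _
    have h5 := neg_abs_le (1 - ε)
    have h6 := abs_nonneg (1 - ε)
    rw [gIntegrand, Real.norm_of_nonneg (le_max_right _ _)]
    exact max_le (by linarith) (by linarith)
  refine hI.of_forall_sdiff_eq_zero measurableSet_Ioi fun t ht => hz t ?_
  by_contra h
  exact ht.2 ⟨ht.1, by linarith⟩

end WassersteinCC

end

/-!
Let `h(t) = Φ(u - t) - Φ(ℓ + t)` be the probability that a standard normal variable lies deeper than
`t` inside `[ℓ, u]`.

*The standardized set.* To lower the probability of `[ℓ, u]` to `1 - ε`, mass `ε` has to be carried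
to the complement, and the cheapest mass to carry is the one closest to it. By the layer cake
formula this costs exactly `g_ε = ∫₀^∞ [h(t) - (1 - ε)]⁺ dt`. If `g_ε < δ`, an explicit map carries
slightly more mass than `ε` at cost at most `δ` (`exists_transport`), which violates the chance
constraint. Conversely, every coupling of `𝒩(0, 1)` with a distribution giving `[ℓ, u]` mass
`q < 1 - ε` costs at least `∫₀^∞ [h(t) - q]⁺ dt` (`lintegral_le_coupling_cost`), which is strictly
more than `g_ε ≥ δ` (`ofReal_gFun_lt`). No optimal coupling is needed.

*Convexity.* Since `ε < 1/2`, the integrand of `g_ε` is positive only where `u - t` and `-(ℓ + t)`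
are positive, and there `h` is jointly concave in `(ℓ, u, t)` because `Φ` is concave on `[0, ∞)`.
If `M` denotes the value of the integrand at `t = 0`, the superlevel sets at equal fractions `τ M`
are intervals starting at `0` whose lengths are concave in `(ℓ, u)`. Integrating over `τ` gives a
Brunn–Minkowski type inequality for `g_ε / M` (`gFun_div_concave`), and the Cauchy–Schwarz
inequality turns it into quasi-concavity of `g_ε` (`convex_standardSet`).

*Higher dimension.* For `x ≠ 0` the form `ξ ↦ xᵀ(ξ - m) / ‖x‖_*` is 1-Lipschitz and maps `𝒩(m, S)`
to `𝒩(0, 1)`, so it maps one ball into the other; transport maps of the line lift to `ℝⁿ` at equal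
cost along a direction in which the form has slope one (`mem_feasibleSet_iff_of_ne_zero`). The cone
over the standardized set has sections that grow as the scale `s` decreases, because `ℓ < 0 < u` on
that set; so the scale may be relaxed to `s ≥ ‖x‖_*`. At scale `0` the closed cone is
`{ℓ ≤ 0 ≤ u}`, which is the constraint for `x = 0`.

*Closedness* holds because `Q[ℓ ≤ xᵀξ ≤ u]` is upper semicontinuous in `(x, ℓ, u)` for each `Q`
(`isClosed_setOf_le_measure`).
-/

namespace WassersteinCC

open scoped Topology

/-! ### The standard normal distribution function -/


instance nullSingletonClass_stdNormal : NullSingletonClass (gaussianReal 0 1) :=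
  nullSingletonClass_gaussianReal one_ne_zero

theorem stdNormal_Ioc (a b : ℝ) :
    gaussianReal 0 1 (Ioc a b) = ENNReal.ofReal (stdNormalCDF b - stdNormalCDF a) := by
  conv_lhs => rw [← measure_cdf (gaussianReal 0 1)]
  exact StieltjesFunction.measure_Ioc _ a b

theorem stdNormal_Icc (a b : ℝ) :
    gaussianReal 0 1 (Icc a b) = ENNReal.ofReal (stdNormalCDF b - stdNormalCDF a) := by
  rw [← stdNormal_Ioc, measure_congr Ioc_ae_eq_Icc]

theorem stdNormal_Ioo (a b : ℝ) :
    gaussianReal 0 1 (Ioo a b) = ENNReal.ofReal (stdNormalCDF b - stdNormalCDF a) := by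
  rw [← stdNormal_Ioc, measure_congr Ioo_ae_eq_Ioc]

theorem stdNormalCDF_mono : Monotone stdNormalCDF := monotone_cdf _

theorem stdNormalCDF_nonneg (r : ℝ) : 0 ≤ stdNormalCDF r := cdf_nonneg _ _

theorem stdNormalCDF_le_one (r : ℝ) : stdNormalCDF r ≤ 1 := cdf_le_one _ _

theorem tendsto_stdNormalCDF_atTop : Tendsto stdNormalCDF atTop (𝓝 1) := tendsto_cdf_atTop _

theorem tendsto_stdNormalCDF_atBot : Tendsto stdNormalCDF atBot (𝓝 0) := tendsto_cdf_atBot _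

theorem stdNormalCDF_eq_integral (r : ℝ) :
    stdNormalCDF r = ∫ x in Iic r, gaussianPDFReal 0 1 x := by
  rw [stdNormalCDF, cdf_eq_real, measureReal_def, gaussianReal_apply_eq_integral 0 one_ne_zero,
    ENNReal.toReal_ofReal]
  exact integral_nonneg fun x => gaussianPDFReal_nonneg _ _ _

theorem continuous_gaussianPDFReal : Continuous (gaussianPDFReal 0 1) := by
  rw [gaussianPDFReal_def]
  fun_prop

theorem hasDerivAt_stdNormalCDF (r : ℝ) :
    HasDerivAt stdNormalCDF (gaussianPDFReal 0 1 r) r := by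
  have hi := integrable_gaussianPDFReal 0 1
  have h : stdNormalCDF = fun r => stdNormalCDF 0 + ∫ x in (0 : ℝ)..r, gaussianPDFReal 0 1 x := by
    funext r
    rw [← intervalIntegral.integral_Iic_sub_Iic hi.integrableOn hi.integrableOn,
      ← stdNormalCDF_eq_integral, ← stdNormalCDF_eq_integral]
    ring
  rw [h]
  exact (intervalIntegral.integral_hasDerivAt_right hi.intervalIntegrable
    (continuous_gaussianPDFReal.stronglyMeasurableAtFilter _ _)
    continuous_gaussianPDFReal.continuousAt).const_add _

theorem continuous_stdNormalCDF : Continuous stdNormalCDF :=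
  continuous_iff_continuousAt.2 fun r => (hasDerivAt_stdNormalCDF r).continuousAt

theorem concaveOn_stdNormalCDF : ConcaveOn ℝ (Ici 0) stdNormalCDF := by
  refine AntitoneOn.concaveOn_of_deriv (convex_Ici 0) continuous_stdNormalCDF.continuousOn
    (fun r _ => (hasDerivAt_stdNormalCDF r).differentiableAt.differentiableWithinAt) ?_
  rw [interior_Ici]
  intro a ha b hb hab
  rw [(hasDerivAt_stdNormalCDF a).deriv, (hasDerivAt_stdNormalCDF b).deriv]
  simp only [gaussianPDFReal_def, mem_Ioi] at *
  gcongr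

theorem stdNormalCDF_neg (r : ℝ) : stdNormalCDF (-r) = 1 - stdNormalCDF r := by
  have h1 : gaussianReal 0 1 (Iic (-r)) = gaussianReal 0 1 (Ioi r) := by
    have h2 : (gaussianReal 0 1).map (fun y => -y) = gaussianReal 0 1 := by
      rw [gaussianReal_map_neg, neg_zero]
    rw [measure_congr Ioi_ae_eq_Ici]
    conv_lhs => rw [← h2, Measure.map_apply measurable_neg measurableSet_Iic]
    congr 1
    ext y
    simp
  have h3 := prob_compl_eq_one_sub (μ := gaussianReal 0 1) (measurableSet_Iic (a := r))
  rw [compl_Iic, ← h1, ← ofReal_cdf, ← ofReal_cdf, ← ENNReal.ofReal_one,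
    ← ENNReal.ofReal_sub _ (cdf_nonneg _ _)] at h3
  exact (ENNReal.ofReal_eq_ofReal_iff (cdf_nonneg _ _)
    (sub_nonneg.2 (cdf_le_one _ _))).1 h3

theorem stdNormalCDF_zero : stdNormalCDF 0 = 1 / 2 := by
  have := stdNormalCDF_neg 0
  rw [neg_zero] at this
  linarith

/-! ### Depth in the interval and the function `g_ε` -/

/-- The probability that a standard normal variable lies in `[ℓ + t, u - t]`, as a signed quantity:
it is negative if the interval is inverted. -/
noncomputable def centralProb (ℓ u t : ℝ) : ℝ := stdNormalCDF (u - t) - stdNormalCDF (ℓ + t)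

/-- The distance from `y` to the complement of `[ℓ, u]`. -/
noncomputable def depth (ℓ u y : ℝ) : ℝ := max 0 (min (y - ℓ) (u - y))

theorem continuous_centralProb (ℓ u : ℝ) : Continuous (centralProb ℓ u) := by
  have := continuous_stdNormalCDF
  unfold centralProb
  fun_prop

theorem antitone_centralProb (ℓ u : ℝ) : Antitone (centralProb ℓ u) := fun s t h =>
  sub_le_sub (stdNormalCDF_mono (by linarith)) (stdNormalCDF_mono (by linarith))

theorem measurable_depth (ℓ u : ℝ) : Measurable (depth ℓ u) := by
  unfold depth
  fun_prop

theorem depth_nonneg (ℓ u y : ℝ) : 0 ≤ depth ℓ u y := le_max_left _ _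

theorem setOf_lt_depth {t : ℝ} (ht : 0 ≤ t) (ℓ u : ℝ) :
    {y | t < depth ℓ u y} = Ioo (ℓ + t) (u - t) := by
  ext y
  simp only [depth, mem_ofPred_eq, lt_max_iff, lt_min_iff, mem_Ioo, not_lt.2 ht, false_or]
  constructor <;> rintro ⟨h1, h2⟩ <;> constructor <;> linarith

theorem setOf_le_depth {t : ℝ} (ht : 0 < t) (ℓ u : ℝ) :
    {y | t ≤ depth ℓ u y} = Icc (ℓ + t) (u - t) := by
  ext y
  simp only [depth, mem_ofPred_eq, le_max_iff, le_min_iff, mem_Icc, not_le.2 ht, false_or]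
  constructor <;> rintro ⟨h1, h2⟩ <;> constructor <;> linarith

theorem depth_le_abs_sub {ℓ u x : ℝ} (hx : ¬ (ℓ ≤ x ∧ x ≤ u)) (y : ℝ) :
    depth ℓ u y ≤ |x - y| := by
  refine max_le (abs_nonneg _) ?_
  by_cases h : ℓ ≤ x
  · have h2 : u < x := not_le.1 fun h' => hx ⟨h, h'⟩
    exact (min_le_right _ _).trans ((by linarith : u - y ≤ x - y).trans (le_abs_self _))
  · exact (min_le_left _ _).trans ((by linarith : y - ℓ ≤ -(x - y)).trans (neg_le_abs _))

theorem gFun_nonneg (ε ℓ u : ℝ) : 0 ≤ gFun ε ℓ u :=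
  integral_nonneg fun _ => le_max_right _ _

theorem ofReal_gFun {ε : ℝ} (hε : ε < 1) (ℓ u : ℝ) :
    ENNReal.ofReal (gFun ε ℓ u) =
      ∫⁻ t in Ioi (0 : ℝ), ENNReal.ofReal (centralProb ℓ u t - (1 - ε)) := by
  rw [gFun, ofReal_integral_eq_lintegral_ofReal (integrableOn_gIntegrand hε ℓ u)
    (ae_of_all _ fun t => le_max_right _ _)]
  refine lintegral_congr fun t => ?_
  rw [gIntegrand, ENNReal.ofReal_max, ENNReal.ofReal_zero]
  exact max_eq_left zero_le

/-- Adding a constant `κ` on `(0, r]` to the integrand of `g_ε` adds `κ r` to the integral. -/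
theorem lintegral_centralProb_add_indicator {ε : ℝ} (hε : ε < 1) (ℓ u κ r : ℝ) :
    ∫⁻ t in Ioi (0 : ℝ), (ENNReal.ofReal (centralProb ℓ u t - (1 - ε)) +
      (Ioc 0 r).indicator (fun _ => ENNReal.ofReal κ) t) =
      ENNReal.ofReal (gFun ε ℓ u) + ENNReal.ofReal κ * ENNReal.ofReal r := by
  rw [lintegral_add_right _ (measurable_const.indicator measurableSet_Ioc), ofReal_gFun hε,
    lintegral_indicator measurableSet_Ioc, setLIntegral_const,
    Measure.restrict_apply measurableSet_Ioc, inter_eq_left.2 Ioc_subset_Ioi_self,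
    Real.volume_Ioc, sub_zero]

/-! ### Optimal transport of mass out of the interval -/

/-- The cost of moving the mass of `{depth < r}` to the boundary of `[ℓ, u]` exceeds `g_ε` by at
most `r` times the mass moved in excess of `ε`. -/
theorem lintegral_depth_le {ε : ℝ} (hε : ε < 1) {ℓ u r : ℝ} (hr : 0 < r)
    (h : centralProb ℓ u r ≤ 1 - ε) :
    ∫⁻ y in {y | depth ℓ u y < r}, ENNReal.ofReal (depth ℓ u y) ∂(gaussianReal 0 1) ≤
      ENNReal.ofReal (gFun ε ℓ u + (1 - ε - centralProb ℓ u r) * r) := by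
  rw [lintegral_eq_lintegral_meas_lt (f := depth ℓ u) _ (ae_of_all _ (depth_nonneg ℓ u))
    (measurable_depth ℓ u).aemeasurable,
    ENNReal.ofReal_add (gFun_nonneg _ _ _) (mul_nonneg (by linarith) hr.le),
    ENNReal.ofReal_mul (by linarith), ← lintegral_centralProb_add_indicator hε]
  refine setLIntegral_mono' measurableSet_Ioi fun t (ht : 0 < t) => ?_
  rw [Measure.restrict_apply (measurableSet_lt measurable_const (measurable_depth ℓ u))]
  rcases lt_or_ge t r with htr | htr
  · have h1 : {y | t < depth ℓ u y} ∩ {y | depth ℓ u y < r} =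
        {y | t < depth ℓ u y} \ {y | r ≤ depth ℓ u y} := by
      ext y
      simp
    have h2 : {y | r ≤ depth ℓ u y} ⊆ {y | t < depth ℓ u y} := fun y hy => htr.trans_le hy
    rw [indicator_of_mem (show t ∈ Ioc 0 r from ⟨ht, htr.le⟩), h1,
      measure_sdiff h2
        (measurableSet_le measurable_const (measurable_depth ℓ u)).nullMeasurableSet
        (measure_ne_top _ _),
      setOf_lt_depth ht.le, setOf_le_depth hr, stdNormal_Ioo, stdNormal_Icc, tsub_le_iff_right]
    change ENNReal.ofReal (centralProb ℓ u t) ≤ _ + ENNReal.ofReal (centralProb ℓ u r)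
    rw [add_assoc]
    refine le_trans ?_ (add_le_add_right ENNReal.ofReal_add_le _)
    refine le_trans ?_ ENNReal.ofReal_add_le
    exact ENNReal.ofReal_le_ofReal (by linarith)
  · have h1 : {y | t < depth ℓ u y} ∩ {y | depth ℓ u y < r} = ∅ := by
      ext y
      simp only [mem_inter_iff, mem_ofPred_eq, mem_empty_iff_false, iff_false, not_and, not_lt]
      exact fun h => htr.trans h.le
    rw [h1, measure_empty]
    exact zero_le

/-- If `g_ε(ℓ, u) < δ`, then mass more than `ε` of the standard normal distribution can be moved out
of `[ℓ, u]` at a cost of at most `δ`. -/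
theorem exists_transport {δ ε ℓ u : ℝ} (hε : ε < 1) (h : gFun ε ℓ u < δ) :
    ∃ T : ℝ → ℝ, Measurable T ∧
      ∫⁻ y, ENNReal.ofReal |T y - y| ∂(gaussianReal 0 1) ≤ ENNReal.ofReal δ ∧
      gaussianReal 0 1 {y | ℓ ≤ T y ∧ T y ≤ u} < ENNReal.ofReal (1 - ε) := by
  rcases lt_or_ge (centralProb ℓ u 0) (1 - ε) with h0 | h0
  · refine ⟨id, measurable_id, by simp, ?_⟩
    change gaussianReal 0 1 (Icc ℓ u) < _
    rw [stdNormal_Icc]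
    refine (ENNReal.ofReal_lt_ofReal_iff (by linarith)).2 ?_
    simpa [centralProb] using h0
  -- `r` is a depth below which the mass is slightly more than `ε`.
  obtain ⟨R, hR0, hR⟩ : ∃ R, 0 < R ∧ centralProb ℓ u R ≤ (1 - ε) / 2 := by
    have h1 : Tendsto (fun t => stdNormalCDF (u - t)) atTop (𝓝 0) :=
      by
      simp_rw [sub_eq_add_neg]
      exact tendsto_stdNormalCDF_atBot.comp
        (tendsto_atBot_add_const_left _ u tendsto_neg_atTop_atBot)
    obtain ⟨R, h2, h3⟩ := ((h1.eventually_lt_const (by linarith : 0 < (1 - ε) / 2)).and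
      (eventually_gt_atTop 0)).exists
    refine ⟨R, h3, ?_⟩
    have := stdNormalCDF_nonneg (ℓ + R)
    unfold centralProb
    linarith
  set κ := min ((1 - ε) / 2) ((δ - gFun ε ℓ u) / (2 * R)) with hκ
  have hκ0 : 0 < κ := lt_min (by linarith) (div_pos (by linarith) (by linarith))
  have hκ1 : κ ≤ (1 - ε) / 2 := min_le_left _ _
  have hκ2 : κ * R ≤ (δ - gFun ε ℓ u) / 2 := by
    have := (le_div_iff₀ (by linarith : 0 < 2 * R)).1
      (min_le_right ((1 - ε) / 2) ((δ - gFun ε ℓ u) / (2 * R)))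
    rw [← hκ] at this
    linarith
  obtain ⟨r, hr, hrv⟩ : ∃ r ∈ Icc 0 R, centralProb ℓ u r = 1 - ε - κ :=
    intermediate_value_Icc' hR0.le (continuous_centralProb ℓ u).continuousOn
      ⟨by linarith, by linarith⟩
  have hr0 : 0 < r := by
    refine lt_of_le_of_ne hr.1 fun h1 => ?_
    rw [← h1] at hrv
    linarith
  set η := (δ - gFun ε ℓ u) / 2 with hη
  have hη0 : 0 < η := by
    rw [hη]
    linarith
  have hm : MeasurableSet {y | depth ℓ u y < r} :=
    measurableSet_lt (measurable_depth ℓ u) measurable_const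
  refine ⟨fun y => if depth ℓ u y < r then
    if y ≤ (ℓ + u) / 2 then min y (ℓ - η) else max y (u + η) else y, ?_, ?_, ?_⟩
  · exact Measurable.ite hm (Measurable.ite measurableSet_Iic (by fun_prop) (by fun_prop))
      measurable_id
  · calc ∫⁻ y, _ ∂(gaussianReal 0 1)
        ≤ ∫⁻ y, ({y | depth ℓ u y < r}.indicator (fun y => ENNReal.ofReal (depth ℓ u y)) y +
            ENNReal.ofReal η) ∂(gaussianReal 0 1) := by
          refine lintegral_mono fun y => ?_
          by_cases hy : depth ℓ u y < r
          · dsimp only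
            rw [indicator_of_mem (by exact hy), if_pos hy,
              ← ENNReal.ofReal_add (depth_nonneg _ _ _) hη0.le]
            refine ENNReal.ofReal_le_ofReal ?_
            have hd0 := depth_nonneg ℓ u y
            have hd1 : min (y - ℓ) (u - y) ≤ depth ℓ u y := le_max_right _ _
            split_ifs with hy2
            · rw [min_eq_left (by linarith)] at hd1
              rw [abs_sub_comm, abs_of_nonneg (sub_nonneg.2 (min_le_left _ _)), sub_le_comm]
              exact le_min (by linarith) (by linarith)
            · rw [min_eq_right (by linarith)] at hd1
              rw [abs_of_nonneg (sub_nonneg.2 (le_max_left _ _)), sub_le_iff_le_add]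
              exact max_le (by linarith) (by linarith)
          · simp [if_neg hy]
      _ = ∫⁻ y in {y | depth ℓ u y < r}, ENNReal.ofReal (depth ℓ u y) ∂(gaussianReal 0 1) +
            ENNReal.ofReal η := by
          rw [lintegral_add_right _ measurable_const, lintegral_indicator hm, lintegral_const,
            measure_univ, mul_one]
      _ ≤ ENNReal.ofReal (gFun ε ℓ u + (1 - ε - centralProb ℓ u r) * r) + ENNReal.ofReal η := by
          gcongr
          exact lintegral_depth_le hε hr0 (by linarith)
      _ ≤ ENNReal.ofReal δ := by
          have h1 : 1 - ε - centralProb ℓ u r = κ := by linarith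
          rw [h1, ← ENNReal.ofReal_add
            (add_nonneg (gFun_nonneg _ _ _) (mul_nonneg hκ0.le hr0.le)) hη0.le]
          have h2 : κ * r ≤ κ * R := mul_le_mul_of_nonneg_left hr.2 hκ0.le
          exact ENNReal.ofReal_le_ofReal (by linarith)
  · refine lt_of_le_of_lt (measure_mono (t := {y | r ≤ depth ℓ u y}) fun y hy => ?_) ?_
    · by_contra hlt
      have hlt : depth ℓ u y < r := not_le.1 hlt
      simp only [mem_ofPred_eq, if_pos hlt] at hy
      split_ifs at hy
      · linarith [min_le_right y (ℓ - η), hy.1]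
      · linarith [le_max_right y (u + η), hy.2]
    · rw [setOf_le_depth hr0, stdNormal_Icc]
      change ENNReal.ofReal (centralProb ℓ u r) < _
      exact (ENNReal.ofReal_lt_ofReal_iff (by linarith)).2 (by linarith)

/-- Any coupling of the standard normal distribution with a distribution of mass `q` on `[ℓ, u]`
costs at least `∫ [centralProb - q]⁺`. -/
theorem lintegral_le_coupling_cost {γ : Measure (ℝ × ℝ)} [IsProbabilityMeasure γ]
    (hγ : γ.map Prod.snd = gaussianReal 0 1) {ℓ u q : ℝ} (hq0 : 0 ≤ q)
    (hq : γ {p | ℓ ≤ p.1 ∧ p.1 ≤ u} = ENNReal.ofReal q) :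
    ∫⁻ t in Ioi (0 : ℝ), ENNReal.ofReal (centralProb ℓ u t - q) ≤
      ∫⁻ p, ENNReal.ofReal |p.1 - p.2| ∂γ := by
  have hA : MeasurableSet {p : ℝ × ℝ | ℓ ≤ p.1 ∧ p.1 ≤ u} :=
    (measurableSet_le measurable_const measurable_fst).inter
      (measurableSet_le measurable_fst measurable_const)
  have hd : Measurable fun p : ℝ × ℝ => depth ℓ u p.2 := (measurable_depth ℓ u).comp measurable_snd
  calc _ ≤ ∫⁻ t in Ioi (0 : ℝ), (γ.restrict {p | ℓ ≤ p.1 ∧ p.1 ≤ u}ᶜ) {p | t < depth ℓ u p.2} := by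
        refine setLIntegral_mono' measurableSet_Ioi fun t (ht : 0 < t) => ?_
        rw [ENNReal.ofReal_sub _ hq0, tsub_le_iff_right, ← hq,
          Measure.restrict_apply (measurableSet_lt measurable_const hd)]
        have h1 : ENNReal.ofReal (centralProb ℓ u t) = γ {p | t < depth ℓ u p.2} := by
          rw [centralProb, ← stdNormal_Ioo, ← setOf_lt_depth ht.le, ← hγ,
            Measure.map_apply measurable_snd
              (measurableSet_lt measurable_const (measurable_depth ℓ u))]
          rfl
        rw [h1]
        refine le_trans (measure_mono fun p hp => ?_) (measure_union_le _ _)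
        by_cases hpA : ℓ ≤ p.1 ∧ p.1 ≤ u
        · exact Or.inr hpA
        · exact Or.inl ⟨hp, hpA⟩
    _ = ∫⁻ p in {p : ℝ × ℝ | ℓ ≤ p.1 ∧ p.1 ≤ u}ᶜ, ENNReal.ofReal (depth ℓ u p.2) ∂γ :=
        (lintegral_eq_lintegral_meas_lt _ (ae_of_all _ fun p => depth_nonneg _ _ _)
          hd.aemeasurable).symm
    _ ≤ ∫⁻ p in {p : ℝ × ℝ | ℓ ≤ p.1 ∧ p.1 ≤ u}ᶜ, ENNReal.ofReal |p.1 - p.2| ∂γ :=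
        setLIntegral_mono' hA.compl fun p hp => ENNReal.ofReal_le_ofReal (depth_le_abs_sub hp _)
    _ ≤ _ := setLIntegral_le_lintegral _ _

theorem ofReal_gFun_lt {ε ℓ u q : ℝ} (hε : ε < 1) (hg : 0 < gFun ε ℓ u) (hq : q < 1 - ε) :
    ENNReal.ofReal (gFun ε ℓ u) <
      ∫⁻ t in Ioi (0 : ℝ), ENNReal.ofReal (centralProb ℓ u t - q) := by
  obtain ⟨r, hr, hrε⟩ : ∃ r, 0 < r ∧ 1 - ε < centralProb ℓ u r := by
    by_contra! h
    have h1 := ofReal_gFun hε ℓ u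
    rw [setLIntegral_congr_fun (g := fun _ => 0) measurableSet_Ioi fun t ht =>
      ENNReal.ofReal_of_nonpos (sub_nonpos.2 (h t ht)), lintegral_zero] at h1
    exact absurd (ENNReal.ofReal_eq_zero.1 h1) (not_le.2 hg)
  refine lt_of_lt_of_le ?_ ((lintegral_centralProb_add_indicator hε ℓ u (1 - ε - q) r).symm.le.trans
    (setLIntegral_mono' measurableSet_Ioi fun t ht => ?_))
  · refine ENNReal.lt_add_right ENNReal.ofReal_ne_top (mul_ne_zero ?_ ?_)
    · exact (ENNReal.ofReal_pos.2 (by linarith)).ne'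
    · exact (ENNReal.ofReal_pos.2 hr).ne'
  · by_cases h : t ∈ Ioc 0 r
    · have := antitone_centralProb ℓ u h.2
      rw [indicator_of_mem h, ← ENNReal.ofReal_add (by linarith) (by linarith)]
      exact ENNReal.ofReal_le_ofReal (by linarith)
    · rw [indicator_of_notMem h, add_zero]
      exact ENNReal.ofReal_le_ofReal (by linarith)

/-! ### Wasserstein distances and maps -/

theorem wassersteinDist_map_le {Ω E : Type*} [MeasurableSpace Ω] [MeasurableSpace E]
    [AddCommGroup E] (N : E → ℝ) {P : Measure Ω} {X Y : Ω → E} (hX : Measurable X)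
    (hY : Measurable Y) (hN : Measurable fun p : E × E => N (p.1 - p.2)) :
    wassersteinDist N (P.map X) (P.map Y) ≤ ∫⁻ ω, ENNReal.ofReal (N (X ω - Y ω)) ∂P := by
  have h : IsCoupling (P.map X) (P.map Y) (P.map fun ω => (X ω, Y ω)) := by
    refine ⟨?_, ?_⟩
    · rw [Measure.map_map measurable_fst (hX.prodMk hY)]
      rfl
    · rw [Measure.map_map measurable_snd (hX.prodMk hY)]
      rfl
  refine (iInf₂_le _ h).trans ?_
  rw [lintegral_map hN.ennreal_ofReal (hX.prodMk hY)]

theorem wassersteinDist_map_le_of_lipschitz {E F : Type*} [MeasurableSpace E] [AddCommGroup E]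
    [MeasurableSpace F] [AddCommGroup F] {N : E → ℝ} {M : F → ℝ} {f : E → F} (hf : Measurable f)
    (hM : Measurable fun p : F × F => M (p.1 - p.2))
    (h : ∀ a b, M (f a - f b) ≤ N (a - b)) (P Q : Measure E) :
    wassersteinDist M (P.map f) (Q.map f) ≤ wassersteinDist N P Q := by
  refine le_iInf₂ fun γ hγ => ?_
  rw [← hγ.1, ← hγ.2, Measure.map_map hf measurable_fst, Measure.map_map hf measurable_snd]
  exact (wassersteinDist_map_le M (hf.comp measurable_fst) (hf.comp measurable_snd) hM).trans
    (lintegral_mono fun p => ENNReal.ofReal_le_ofReal (h _ _))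

theorem wassersteinDist_self {E : Type*} [MeasurableSpace E] [AddCommGroup E] {N : E → ℝ}
    (h0 : N 0 = 0) (hN : Measurable fun p : E × E => N (p.1 - p.2)) (P : Measure E) :
    wassersteinDist N P P = 0 := by
  have := wassersteinDist_map_le N (P := P) measurable_id measurable_id hN
  simpa [h0] using this

theorem measurable_abs_sub : Measurable fun p : ℝ × ℝ => |p.1 - p.2| := by fun_prop

/-! ### The standardized set -/

theorem mem_standardSet {δ ε : ℝ} {z : ℝ × ℝ} :
    z ∈ standardSet δ ε ↔ ∀ Q ∈ wassersteinBall (fun r : ℝ => |r|) (gaussianReal 0 1) δ,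
      ENNReal.ofReal (1 - ε) ≤ Q (Icc z.1 z.2) := by
  rw [standardSet, mem_ofPred_eq, le_iInf₂_iff]
  rfl

theorem mem_standardSet_iff {δ ε : ℝ} (hδ : 0 < δ) (hε : ε < 1) (z : ℝ × ℝ) :
    z ∈ standardSet δ ε ↔ δ ≤ gFun ε z.1 z.2 := by
  obtain ⟨ℓ, u⟩ := z
  constructor
  · intro hz
    by_contra! h
    obtain ⟨T, hT, hcost, hprob⟩ := exists_transport hε h
    have hball : (gaussianReal 0 1).map T ∈
        wassersteinBall (fun r : ℝ => |r|) (gaussianReal 0 1) δ := by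
      refine ⟨Measure.isProbabilityMeasure_map hT.aemeasurable, ?_⟩
      have := wassersteinDist_map_le (fun r : ℝ => |r|) (P := gaussianReal 0 1) hT measurable_id
        measurable_abs_sub
      rw [Measure.map_id] at this
      exact this.trans hcost
    have h1 := mem_standardSet.1 hz _ hball
    rw [Measure.map_apply hT measurableSet_Icc] at h1
    exact absurd h1 (not_le.2 hprob)
  · intro h
    refine mem_standardSet.2 fun Q hQ => ?_
    by_contra! hlt
    have := hQ.1
    set q := (Q (Icc ℓ u)).toReal with hq
    have hqQ : ENNReal.ofReal q = Q (Icc ℓ u) := ENNReal.ofReal_toReal (measure_ne_top _ _)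
    have hq1 : q < 1 - ε := by
      refine (ENNReal.ofReal_lt_ofReal_iff (by linarith)).1 ?_
      rw [hqQ]
      exact hlt
    refine absurd hQ.2 (not_le.2 ?_)
    refine (ENNReal.ofReal_le_ofReal h).trans_lt
      ((ofReal_gFun_lt hε (hδ.trans_le h) hq1).trans_le ?_)
    refine le_iInf₂ fun γ hγ => ?_
    have hγp : IsProbabilityMeasure γ := by
      refine ⟨?_⟩
      rw [← preimage_univ (f := Prod.fst), ← Measure.map_apply measurable_fst MeasurableSet.univ,
        hγ.1, measure_univ]
    refine lintegral_le_coupling_cost hγ.2 ENNReal.toReal_nonneg ?_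
    rw [hqQ, ← hγ.1, Measure.map_apply measurable_fst measurableSet_Icc]
    rfl

/-! ### Closedness -/

/-- For a finite measure `Q`, the value `Q (F x)` is upper semicontinuous in `x` if membership in
`F x` is a closed condition on `x`, by continuity from above. -/
theorem isClosed_setOf_le_measure {X Ω : Type*} [TopologicalSpace X] [SequentialSpace X]
    [MeasurableSpace Ω] (Q : Measure Ω) [IsFiniteMeasure Q] {F : X → Set Ω}
    (hF : ∀ x, MeasurableSet (F x)) (hc : ∀ ω, IsClosed {x | ω ∈ F x}) (c : ℝ≥0∞) :
    IsClosed {x | c ≤ Q (F x)} := by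
  refine IsSeqClosed.isClosed fun x a hx ha => ?_
  have hanti : Antitone fun n => ⋃ k ≥ n, F (x k) := fun i j hij =>
    iUnion_mono fun k => iUnion_mono' fun hk => ⟨hij.trans hk, subset_rfl⟩
  have hsub : ⋂ n, ⋃ k ≥ n, F (x k) ⊆ F a := by
    intro ω hω
    refine (hc ω).mem_of_frequently_of_tendsto (frequently_atTop.2 fun n => ?_) ha
    obtain ⟨k, hk, hωk⟩ := mem_iUnion₂.1 (mem_iInter.1 hω n)
    exact ⟨k, hk, hωk⟩
  refine le_trans ?_ (measure_mono hsub)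
  rw [hanti.measure_iInter (fun n => (MeasurableSet.biUnion (to_countable _)
    fun k _ => hF _).nullMeasurableSet) ⟨0, measure_ne_top _ _⟩]
  exact le_iInf fun n => (hx n).trans (measure_mono (subset_biUnion_of_mem (u := fun k => F (x k))
    (show n ∈ {k | k ≥ n} from le_refl n)))

theorem isClosed_standardSet (δ ε : ℝ) : IsClosed (standardSet δ ε) := by
  have h : standardSet δ ε = ⋂ Q ∈ wassersteinBall (fun r : ℝ => |r|) (gaussianReal 0 1) δ,
      {z | ENNReal.ofReal (1 - ε) ≤ Q (Icc z.1 z.2)} := by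
    ext z
    rw [mem_standardSet, mem_iInter₂]
    rfl
  rw [h]
  refine isClosed_biInter fun Q hQ => ?_
  have := hQ.1
  exact isClosed_setOf_le_measure (F := fun z : ℝ × ℝ => Icc z.1 z.2) Q (fun z => measurableSet_Icc)
    (fun ω => (isClosed_le continuous_fst continuous_const).inter
      (isClosed_le continuous_const continuous_snd)) _

/-! ### Convexity of the standardized set -/

/-- The quantity `Φ(u - t) - Φ(ℓ + t) - (1 - ε)` at `z = (ℓ, u)`, whose positive part is the
integrand of `g_ε`. -/
noncomputable def excess (ε : ℝ) (z : ℝ × ℝ) (t : ℝ) : ℝ := centralProb z.1 z.2 t - (1 - ε)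

theorem antitone_excess (ε : ℝ) (z : ℝ × ℝ) : Antitone (excess ε z) := fun _ _ h =>
  sub_le_sub_right (antitone_centralProb _ _ h) _

theorem continuous_excess (ε : ℝ) (z : ℝ × ℝ) : Continuous (excess ε z) :=
  (continuous_centralProb _ _).sub continuous_const

theorem pos_of_excess_pos {ε : ℝ} (hε : ε < 1 / 2) {z : ℝ × ℝ} {t : ℝ} (h : 0 < excess ε z t) :
    0 < z.2 - t ∧ 0 < -(z.1 + t) := by
  have h1 := stdNormalCDF_zero
  have h2 := stdNormalCDF_nonneg (z.1 + t)
  have h3 := stdNormalCDF_le_one (z.2 - t)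
  unfold excess centralProb at h
  constructor
  · by_contra! h4
    have := stdNormalCDF_mono h4
    linarith
  · by_contra! h4
    have := stdNormalCDF_mono (show 0 ≤ z.1 + t by linarith)
    linarith

theorem excess_concave {ε : ℝ} (hε : ε < 1 / 2) {z w : ℝ × ℝ} {s t a b : ℝ}
    (hz : 0 < excess ε z s) (hw : 0 < excess ε w t) (ha : 0 ≤ a) (hb : 0 ≤ b) (hab : a + b = 1) :
    a * excess ε z s + b * excess ε w t ≤ excess ε (a • z + b • w) (a * s + b * t) := by
  obtain ⟨hz1, hz2⟩ := pos_of_excess_pos hε hz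
  obtain ⟨hw1, hw2⟩ := pos_of_excess_pos hε hw
  have h1 := concaveOn_stdNormalCDF.2 hz1.le hw1.le ha hb hab
  have h2 := concaveOn_stdNormalCDF.2 hz2.le hw2.le ha hb hab
  -- The reflection `Φ(-r) = 1 - Φ(r)` turns both tails into values of `Φ` on `[0, ∞)`.
  have h3 := stdNormalCDF_neg (z.1 + s)
  have h4 := stdNormalCDF_neg (w.1 + t)
  have h5 := stdNormalCDF_neg ((a • z + b • w).1 + (a * s + b * t))
  have e1 : (a • z + b • w).2 - (a * s + b * t) = a • (z.2 - s) + b • (w.2 - t) := by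
    simp only [Prod.snd_add, Prod.smul_snd, smul_eq_mul]
    ring
  have e2 : -((a • z + b • w).1 + (a * s + b * t)) = a • -(z.1 + s) + b • -(w.1 + t) := by
    simp only [Prod.fst_add, Prod.smul_fst, smul_eq_mul]
    ring
  rw [e2] at h5
  unfold excess centralProb
  rw [e1]
  simp only [smul_eq_mul] at *
  have h6 : a * stdNormalCDF (-(z.1 + s)) = a * (1 - stdNormalCDF (z.1 + s)) := by rw [h3]
  have h7 : b * stdNormalCDF (-(w.1 + t)) = b * (1 - stdNormalCDF (w.1 + t)) := by rw [h4]
  linear_combination h1 + h2 - h6 - h7 + h5 + (ε - 2) * hab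

theorem excess_zero_pos {ε : ℝ} {z : ℝ × ℝ} (hg : 0 < gFun ε z.1 z.2) : 0 < excess ε z 0 := by
  by_contra! h
  refine hg.ne' ?_
  rw [gFun, setIntegral_congr_fun (g := fun _ => 0) measurableSet_Ioi fun t (ht : 0 < t) => ?_,
    integral_zero]
  exact max_eq_right ((antitone_excess ε z ht.le).trans h)

/-- The layer cake formula for `g_ε`, with heights measured in units of `M`. -/
theorem ofReal_gFun_div {ε M : ℝ} (hε : ε < 1) (hM : 0 < M) (z : ℝ × ℝ) :
    ENNReal.ofReal (gFun ε z.1 z.2 / M) =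
      ∫⁻ τ in Ioi (0 : ℝ), volume (Ioi 0 ∩ {t | M * τ ≤ excess ε z t}) := by
  have hI := (integrableOn_gIntegrand hε z.1 z.2).div_const M
  have hnn : ∀ t, 0 ≤ gIntegrand ε z.1 z.2 t / M := fun t => div_nonneg (le_max_right _ _) hM.le
  rw [gFun, ← integral_div, ofReal_integral_eq_lintegral_ofReal hI (ae_of_all _ hnn),
    lintegral_eq_lintegral_meas_le _ (ae_of_all _ hnn) hI.aemeasurable]
  refine setLIntegral_congr_fun measurableSet_Ioi fun τ (hτ : 0 < τ) => ?_
  have : {t | τ ≤ gIntegrand ε z.1 z.2 t / M} = {t | M * τ ≤ excess ε z t} := by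
    ext t
    simp only [mem_ofPred_eq, le_div_iff₀ hM, gIntegrand, le_max_iff, mul_comm τ M]
    exact or_iff_left (not_le.2 (mul_pos hM hτ))
  rw [this, Measure.restrict_apply
    (measurableSet_le measurable_const (continuous_excess ε z).measurable), inter_comm]

/-- The superlevel set of `excess` at a positive height not exceeding its value at `0` is an
interval that starts at `0`. -/
theorem exists_superlevel_bound {ε y : ℝ} (hε : ε < 1 / 2) {z : ℝ × ℝ} (hy : 0 < y)
    (hz : y ≤ excess ε z 0) : ∃ r, 0 ≤ r ∧ y ≤ excess ε z r ∧
      volume (Ioi 0 ∩ {t | y ≤ excess ε z t}) ≤ ENNReal.ofReal r := by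
  have hc : IsCompact (Icc 0 z.2 ∩ {t | y ≤ excess ε z t}) :=
    isCompact_Icc.inter_right (isClosed_le continuous_const (continuous_excess ε z))
  have hbd : ∀ t, y ≤ excess ε z t → t ≤ z.2 := fun t ht => by
    linarith [(pos_of_excess_pos hε (hy.trans_le ht)).1]
  obtain ⟨r, hr, hmax⟩ := hc.exists_isGreatest ⟨0, ⟨le_rfl, hbd 0 hz⟩, hz⟩
  refine ⟨r, hr.1.1, hr.2, ?_⟩
  calc volume (Ioi 0 ∩ {t | y ≤ excess ε z t}) ≤ volume (Ioc 0 r) := by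
        refine measure_mono fun t ht => ⟨ht.1, hmax ⟨⟨?_, hbd t ht.2⟩, ht.2⟩⟩
        exact le_of_lt ht.1
    _ = ENNReal.ofReal r := by rw [Real.volume_Ioc, sub_zero]

/-- One-dimensional Brunn–Minkowski inequality for the superlevel sets of `excess` at equal
fractions `τ` of their maximal heights. -/
theorem superlevel_volume_concave {ε : ℝ} (hε : ε < 1 / 2) {z w : ℝ × ℝ} {a b τ : ℝ}
    (hz : 0 < excess ε z 0) (hw : 0 < excess ε w 0) (ha : 0 ≤ a) (hb : 0 ≤ b) (hab : a + b = 1)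
    (hτ : 0 < τ) :
    ENNReal.ofReal a * volume (Ioi 0 ∩ {t | excess ε z 0 * τ ≤ excess ε z t}) +
      ENNReal.ofReal b * volume (Ioi 0 ∩ {t | excess ε w 0 * τ ≤ excess ε w t}) ≤
    volume (Ioi 0 ∩ {t | (a * excess ε z 0 + b * excess ε w 0) * τ ≤
      excess ε (a • z + b • w) t}) := by
  rcases le_or_gt τ 1 with hτ1 | hτ1
  · obtain ⟨r, hr0, hr, hrv⟩ := exists_superlevel_bound hε (mul_pos hz hτ)
      (mul_le_of_le_one_right hz.le hτ1)
    obtain ⟨s, hs0, hs, hsv⟩ := exists_superlevel_bound hε (mul_pos hw hτ)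
      (mul_le_of_le_one_right hw.le hτ1)
    calc _ ≤ ENNReal.ofReal a * ENNReal.ofReal r + ENNReal.ofReal b * ENNReal.ofReal s := by gcongr
      _ = volume (Ioc 0 (a * r + b * s)) := by
        rw [Real.volume_Ioc, sub_zero, ENNReal.ofReal_add (mul_nonneg ha hr0) (mul_nonneg hb hs0),
          ENNReal.ofReal_mul ha, ENNReal.ofReal_mul hb]
      _ ≤ _ := by
        refine measure_mono fun t ht => ⟨ht.1, ?_⟩
        have h1 := excess_concave hε ((mul_pos hz hτ).trans_le hr) ((mul_pos hw hτ).trans_le hs)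
          ha hb hab
        have h2 := antitone_excess ε (a • z + b • w) ht.2
        have h3 := mul_le_mul_of_nonneg_left hr ha
        have h4 := mul_le_mul_of_nonneg_left hs hb
        change _ * τ ≤ _
        linarith
  · have hempty : ∀ v : ℝ × ℝ, 0 < excess ε v 0 →
        Ioi 0 ∩ {t | excess ε v 0 * τ ≤ excess ε v t} = ∅ := by
      intro v hv
      ext t
      simp only [mem_inter_iff, mem_Ioi, mem_ofPred_eq, mem_empty_iff_false, iff_false, not_and,
        not_le]
      exact fun ht => (antitone_excess ε v ht.le).trans_lt (lt_mul_of_one_lt_right hv hτ1)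
    rw [hempty z hz, hempty w hw]
    simp

theorem gFun_div_concave {ε : ℝ} (hε : ε < 1 / 2) {z w : ℝ × ℝ} {a b : ℝ}
    (hz : 0 < excess ε z 0) (hw : 0 < excess ε w 0) (ha : 0 ≤ a) (hb : 0 ≤ b) (hab : a + b = 1) :
    a * (gFun ε z.1 z.2 / excess ε z 0) + b * (gFun ε w.1 w.2 / excess ε w 0) ≤
      gFun ε (a • z + b • w).1 (a • z + b • w).2 / (a * excess ε z 0 + b * excess ε w 0) := by
  have hε' : ε < 1 := by linarith
  have hM : 0 < a * excess ε z 0 + b * excess ε w 0 := by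
    rcases ha.eq_or_lt with rfl | ha'
    · rw [zero_add] at hab
      rw [hab]
      linarith
    · exact add_pos_of_pos_of_nonneg (mul_pos ha' hz) (mul_nonneg hb hw.le)
  have hz' : 0 ≤ gFun ε z.1 z.2 / excess ε z 0 := div_nonneg (gFun_nonneg _ _ _) hz.le
  have hw' : 0 ≤ gFun ε w.1 w.2 / excess ε w 0 := div_nonneg (gFun_nonneg _ _ _) hw.le
  have hmeas : Measurable fun τ : ℝ =>
      ENNReal.ofReal b * volume (Ioi 0 ∩ {t | excess ε w 0 * τ ≤ excess ε w t}) := by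
    refine Measurable.const_mul (Antitone.measurable fun σ τ hστ => ?_) _
    refine measure_mono fun t ht => ⟨ht.1, ?_⟩
    exact (mul_le_mul_of_nonneg_left hστ hw.le).trans ht.2
  refine (ENNReal.ofReal_le_ofReal_iff (div_nonneg (gFun_nonneg _ _ _) hM.le)).1 ?_
  rw [ENNReal.ofReal_add (mul_nonneg ha hz') (mul_nonneg hb hw'), ENNReal.ofReal_mul ha,
    ENNReal.ofReal_mul hb, ofReal_gFun_div hε' hz, ofReal_gFun_div hε' hw,
    ofReal_gFun_div hε' hM, ← lintegral_const_mul' _ _ ENNReal.ofReal_ne_top,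
    ← lintegral_const_mul' _ _ ENNReal.ofReal_ne_top, ← lintegral_add_right _ hmeas]
  exact setLIntegral_mono' measurableSet_Ioi fun τ hτ =>
    superlevel_volume_concave hε hz hw ha hb hab hτ

theorem convex_standardSet {δ ε : ℝ} (hδ : 0 < δ) (hε : ε < 1 / 2) :
    Convex ℝ (standardSet δ ε) := by
  have hε' : ε < 1 := by linarith
  intro z hz w hw a b ha hb hab
  rw [mem_standardSet_iff hδ hε'] at *
  have hM := excess_zero_pos (hδ.trans_le hz)
  have hL := excess_zero_pos (hδ.trans_le hw)
  have h1 := gFun_div_concave hε hM hL ha hb hab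
  set M := excess ε z 0
  set L := excess ε w 0
  have hpos : 0 < a * M + b * L := by
    rcases ha.eq_or_lt with rfl | ha'
    · rw [zero_add] at hab
      rw [hab]
      linarith
    · exact add_pos_of_pos_of_nonneg (mul_pos ha' hM) (mul_nonneg hb hL.le)
  rw [le_div_iff₀ hpos] at h1
  refine le_trans ?_ h1
  have h2 : a * (δ / M) + b * (δ / L) ≤ a * (gFun ε z.1 z.2 / M) + b * (gFun ε w.1 w.2 / L) := by
    gcongr
  refine le_trans ?_ (mul_le_mul_of_nonneg_right h2 hpos.le)
  -- The Cauchy-Schwarz inequality `(a + b)² ≤ (a / M + b / L) (a M + b L)`.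
  have h3 : (a * (δ / M) + b * (δ / L)) * (a * M + b * L) =
      δ * (a + b) ^ 2 + δ * (a * b) * ((M - L) ^ 2 / (M * L)) := by
    field_simp
    ring
  rw [h3, hab, one_pow, mul_one]
  exact le_add_of_nonneg_right (by positivity)

/-! ### The ellipsoidal norm and its dual -/

section

variable {n : ℕ} {m : EuclideanSpace ℝ (Fin n)} {S : Matrix (Fin n) (Fin n) ℝ}

/-- The operator `S^{1/2}` on Euclidean space. -/
noncomputable def sqrtOp (S : Matrix (Fin n) (Fin n) ℝ) :
    EuclideanSpace ℝ (Fin n) →L[ℝ] EuclideanSpace ℝ (Fin n) :=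
  Matrix.toEuclideanCLM (𝕜 := ℝ) (CFC.sqrt S)

theorem isUnit_sqrt (hS : S.PosDef) : IsUnit (CFC.sqrt S) := by
  have h : IsUnit (CFC.sqrt S * CFC.sqrt S) := by
    rw [CFC.sqrt_mul_sqrt_self _ hS.posSemidef.nonneg]
    exact hS.isUnit
  exact isUnit_of_mul_isUnit_left h

theorem isUnit_det_sqrt (hS : S.PosDef) : IsUnit (CFC.sqrt S).det :=
  (Matrix.isUnit_iff_isUnit_det _).1 (isUnit_sqrt hS)

theorem sqrtOp_inv_apply (hS : S.PosDef) (v : EuclideanSpace ℝ (Fin n)) :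
    sqrtOp S (Matrix.toEuclideanCLM (𝕜 := ℝ) (CFC.sqrt S)⁻¹ v) = v := by
  rw [sqrtOp, ← mul_apply_eq_comp, ← map_mul,
    Matrix.mul_nonsing_inv _ (isUnit_det_sqrt hS), map_one]
  rfl

theorem inv_sqrtOp_apply (hS : S.PosDef) (v : EuclideanSpace ℝ (Fin n)) :
    Matrix.toEuclideanCLM (𝕜 := ℝ) (CFC.sqrt S)⁻¹ (sqrtOp S v) = v := by
  rw [sqrtOp, ← mul_apply_eq_comp, ← map_mul,
    Matrix.nonsing_inv_mul _ (isUnit_det_sqrt hS), map_one]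
  rfl

theorem inner_sqrtOp (S : Matrix (Fin n) (Fin n) ℝ) (x y : EuclideanSpace ℝ (Fin n)) :
    inner ℝ x (sqrtOp S y) = inner ℝ (sqrtOp S x) y := by
  have h : IsSelfAdjoint (sqrtOp S) := (CFC.sqrt_nonneg S).isSelfAdjoint.map _
  rw [← ContinuousLinearMap.adjoint_inner_left, h.adjoint_eq]

theorem ellipsoidalNorm_sqrtOp (hS : S.PosDef) (v : EuclideanSpace ℝ (Fin n)) :
    ellipsoidalNorm S (sqrtOp S v) = ‖v‖ := by
  rw [ellipsoidalNorm, inv_sqrtOp_apply hS]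

theorem ellipsoidalNorm_smul (c : ℝ) (v : EuclideanSpace ℝ (Fin n)) :
    ellipsoidalNorm S (c • v) = |c| * ellipsoidalNorm S v := by
  rw [ellipsoidalNorm, map_smul, norm_smul, Real.norm_eq_abs, ellipsoidalNorm]

theorem measurable_ellipsoidalNorm_sub (S : Matrix (Fin n) (Fin n) ℝ) :
    Measurable fun p : EuclideanSpace ℝ (Fin n) × EuclideanSpace ℝ (Fin n) =>
      ellipsoidalNorm S (p.1 - p.2) := by
  unfold ellipsoidalNorm
  fun_prop

theorem inner_le_norm_sqrtOp_mul (hS : S.PosDef) (x v : EuclideanSpace ℝ (Fin n)) :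
    inner ℝ x v ≤ ‖sqrtOp S x‖ * ellipsoidalNorm S v := by
  conv_lhs => rw [← sqrtOp_inv_apply hS v, inner_sqrtOp]
  exact real_inner_le_norm _ _

theorem abs_inner_le_norm_sqrtOp_mul (hS : S.PosDef) (x v : EuclideanSpace ℝ (Fin n)) :
    |inner ℝ x v| ≤ ‖sqrtOp S x‖ * ellipsoidalNorm S v := by
  conv_lhs => rw [← sqrtOp_inv_apply hS v, inner_sqrtOp]
  exact abs_real_inner_le_norm _ _

/-- The direction in which the linear form `x` grows fastest for the ellipsoidal norm. -/
noncomputable def steepest (S : Matrix (Fin n) (Fin n) ℝ) (x : EuclideanSpace ℝ (Fin n)) :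
    EuclideanSpace ℝ (Fin n) :=
  sqrtOp S (‖sqrtOp S x‖⁻¹ • sqrtOp S x)

theorem ellipsoidalNorm_steepest_le (hS : S.PosDef) (x : EuclideanSpace ℝ (Fin n)) :
    ellipsoidalNorm S (steepest S x) ≤ 1 := by
  rw [steepest, ellipsoidalNorm_sqrtOp hS, norm_smul, norm_inv, norm_norm]
  exact inv_mul_le_one

theorem inner_steepest (S : Matrix (Fin n) (Fin n) ℝ) (x : EuclideanSpace ℝ (Fin n)) :
    inner ℝ x (steepest S x) = ‖sqrtOp S x‖ := by
  rw [steepest, inner_sqrtOp, inner_smul_right, real_inner_self_eq_norm_sq]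
  rcases eq_or_ne ‖sqrtOp S x‖ 0 with h | h
  · simp [h]
  · field_simp

theorem dualNorm_eq (hS : S.PosDef) (x : EuclideanSpace ℝ (Fin n)) :
    dualNorm (ellipsoidalNorm S) x = ‖sqrtOp S x‖ := by
  refine IsGreatest.csSup_eq ⟨⟨steepest S x, ellipsoidalNorm_steepest_le hS x,
    (inner_steepest S x).symm⟩, ?_⟩
  rintro r ⟨v, hv, rfl⟩
  exact (inner_le_norm_sqrtOp_mul hS x v).trans (mul_le_of_le_one_right (norm_nonneg _) hv)

theorem norm_sqrtOp_eq_zero (hS : S.PosDef) {x : EuclideanSpace ℝ (Fin n)} :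
    ‖sqrtOp S x‖ = 0 ↔ x = 0 := by
  rw [norm_eq_zero]
  refine ⟨fun h => ?_, fun h => by rw [h, map_zero]⟩
  rw [← inv_sqrtOp_apply hS x, h, map_zero]

/-! ### Reduction of the feasible set to dimension one -/

/-- The affine form `ξ ↦ xᵀ (ξ - m) / ‖x‖_*`, which has dual norm one. -/
noncomputable def standardize (m : EuclideanSpace ℝ (Fin n)) (S : Matrix (Fin n) (Fin n) ℝ)
    (x ξ : EuclideanSpace ℝ (Fin n)) : ℝ :=
  (inner ℝ x ξ - inner ℝ x m) / ‖sqrtOp S x‖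

theorem measurable_standardize (x : EuclideanSpace ℝ (Fin n)) :
    Measurable (standardize m S x) := by
  unfold standardize
  fun_prop

theorem map_standardize (hS : S.PosDef) {x : EuclideanSpace ℝ (Fin n)} (hx : x ≠ 0) :
    (multivariateGaussian m S).map (standardize m S x) = gaussianReal 0 1 := by
  have hσ : ‖sqrtOp S x‖ ≠ 0 := fun h => hx ((norm_sqrtOp_eq_zero hS).1 h)
  set L : StrongDual ℝ (EuclideanSpace ℝ (Fin n)) := innerSL ℝ (‖sqrtOp S x‖⁻¹ • sqrtOp S x) with hL
  have hnorm : ‖L‖ = 1 := by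
    rw [hL, innerSL_apply_norm, norm_smul, norm_inv, norm_norm, inv_mul_cancel₀ hσ]
  rw [multivariateGaussian, Measure.map_map (measurable_standardize x) (by fun_prop)]
  have hcomp : (standardize m S x ∘ fun y => m + Matrix.toEuclideanCLM (𝕜 := ℝ) (CFC.sqrt S) y) =
      L := by
    funext y
    change (inner ℝ x (m + sqrtOp S y) - inner ℝ x m) / ‖sqrtOp S x‖ = inner ℝ _ y
    rw [inner_add_right, add_sub_cancel_left, inner_sqrtOp, real_inner_smul_left, div_eq_inv_mul]
  rw [hcomp, IsGaussian.map_eq_gaussianReal, integral_strongDual_stdGaussian,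
    variance_dual_stdGaussian, hnorm]
  simp

theorem mem_feasibleSet {δ ε : ℝ} {z : EuclideanSpace ℝ (Fin n) × ℝ × ℝ} :
    z ∈ feasibleSet m S δ ε ↔
      ∀ Q ∈ wassersteinBall (ellipsoidalNorm S) (multivariateGaussian m S) δ,
        ENNReal.ofReal (1 - ε) ≤ Q {ξ | z.2.1 ≤ inner ℝ z.1 ξ ∧ inner ℝ z.1 ξ ≤ z.2.2} := by
  rw [feasibleSet, mem_ofPred_eq, le_iInf₂_iff]

theorem setOf_inner_mem_eq_preimage (hS : S.PosDef) {x : EuclideanSpace ℝ (Fin n)} (hx : x ≠ 0)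
    (l u : ℝ) :
    {ξ | l ≤ inner ℝ x ξ ∧ inner ℝ x ξ ≤ u} = standardize m S x ⁻¹'
      Icc ((l - inner ℝ x m) / ‖sqrtOp S x‖) ((u - inner ℝ x m) / ‖sqrtOp S x‖) := by
  have hσ : 0 < ‖sqrtOp S x‖ :=
    lt_of_le_of_ne (norm_nonneg _) fun h => hx ((norm_sqrtOp_eq_zero hS).1 h.symm)
  ext ξ
  simp only [mem_ofPred_eq, mem_preimage, mem_Icc, standardize, div_le_div_iff_of_pos_right hσ,
    sub_le_sub_iff_right]

/-- A distribution in the ball around `𝒩(m, S)` projects to one in the ball around `𝒩(0, 1)`, as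
`standardize` is 1-Lipschitz. Conversely, a transport map on the line lifts to the transport
`ξ ↦ ξ + (T y - y) v`, with `y` the standardized value of `ξ` and `v` the steepest direction, at
the same cost. -/
theorem mem_feasibleSet_iff_of_ne_zero (hS : S.PosDef) {δ ε : ℝ} (hδ : 0 < δ)
    (hε : ε < 1) {x : EuclideanSpace ℝ (Fin n)} (hx : x ≠ 0) (l u : ℝ) :
    (x, l, u) ∈ feasibleSet m S δ ε ↔
      ((l - inner ℝ x m) / ‖sqrtOp S x‖, (u - inner ℝ x m) / ‖sqrtOp S x‖) ∈ standardSet δ ε := by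
  have hσ : 0 < ‖sqrtOp S x‖ :=
    lt_of_le_of_ne (norm_nonneg _) fun h => hx ((norm_sqrtOp_eq_zero hS).1 h.symm)
  have hf := measurable_standardize (m := m) (S := S) x
  rw [mem_feasibleSet]
  simp only [setOf_inner_mem_eq_preimage (m := m) hS hx]
  constructor
  · intro h
    rw [mem_standardSet_iff hδ hε]
    by_contra! hg
    obtain ⟨T, hT, hcost, hprob⟩ := exists_transport hε hg
    set X : EuclideanSpace ℝ (Fin n) → EuclideanSpace ℝ (Fin n) := fun ξ =>
      ξ + (T (standardize m S x ξ) - standardize m S x ξ) • steepest S x with hX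
    have hXm : Measurable X :=
      measurable_id.add (((hT.comp hf).sub hf).smul measurable_const)
    have hXs : ∀ ξ, standardize m S x (X ξ) = T (standardize m S x ξ) := by
      intro ξ
      have h1 : inner ℝ x (X ξ) = inner ℝ x ξ +
          (T (standardize m S x ξ) - standardize m S x ξ) * ‖sqrtOp S x‖ := by
        rw [hX, inner_add_right, real_inner_smul_right, inner_steepest]
      rw [standardize, h1, add_sub_right_comm, add_div, mul_div_cancel_right₀ _ hσ.ne']
      change standardize m S x ξ + _ = _
      ring
    have hball : (multivariateGaussian m S).map X ∈
        wassersteinBall (ellipsoidalNorm S) (multivariateGaussian m S) δ := by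
      refine ⟨Measure.isProbabilityMeasure_map hXm.aemeasurable, ?_⟩
      have h1 := wassersteinDist_map_le (ellipsoidalNorm S) (P := multivariateGaussian m S) hXm
        measurable_id (measurable_ellipsoidalNorm_sub S)
      rw [Measure.map_id] at h1
      refine h1.trans (le_trans (lintegral_mono (g := fun ξ => ENNReal.ofReal
        |T (standardize m S x ξ) - standardize m S x ξ|) fun ξ => ?_) ?_)
      · refine ENNReal.ofReal_le_ofReal ?_
        rw [id, hX, add_sub_cancel_left, ellipsoidalNorm_smul]
        exact mul_le_of_le_one_right (abs_nonneg _) (ellipsoidalNorm_steepest_le hS x)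
      · rw [← map_standardize (m := m) hS hx, lintegral_map (by fun_prop) hf] at hcost
        exact hcost
    have h2 := h _ hball
    rw [Measure.map_apply hXm (hf measurableSet_Icc)] at h2
    refine absurd h2 (not_le.2 ?_)
    change gaussianReal 0 1 (T ⁻¹' Icc _ _) < _ at hprob
    rw [← map_standardize (m := m) hS hx, Measure.map_apply hf (hT measurableSet_Icc)] at hprob
    convert hprob using 2
    ext ξ
    simp only [mem_preimage, hXs]
  · intro h Q hQ
    have := hQ.1
    rw [← Measure.map_apply hf measurableSet_Icc]
    refine mem_standardSet.1 h _ ⟨Measure.isProbabilityMeasure_map hf.aemeasurable, ?_⟩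
    rw [← map_standardize (m := m) hS hx]
    refine (wassersteinDist_map_le_of_lipschitz hf measurable_abs_sub (fun a b => ?_) _ _).trans
      hQ.2
    have h1 : standardize m S x a - standardize m S x b = inner ℝ x (a - b) / ‖sqrtOp S x‖ := by
      rw [standardize, standardize, inner_sub_right]
      ring
    rw [h1, abs_div, abs_of_pos hσ, div_le_iff₀' hσ]
    exact abs_inner_le_norm_sqrtOp_mul hS x _

theorem mem_feasibleSet_zero {δ ε : ℝ} (hε₀ : 0 < ε) (hε : ε < 1) (l u : ℝ) :
    ((0 : EuclideanSpace ℝ (Fin n)), l, u) ∈ feasibleSet m S δ ε ↔ l ≤ 0 ∧ 0 ≤ u := by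
  rw [mem_feasibleSet]
  simp only [inner_zero_left]
  constructor
  · intro h
    by_contra hlu
    have h0 : ellipsoidalNorm S 0 = 0 := by rw [ellipsoidalNorm, map_zero, norm_zero]
    have h1 := h (multivariateGaussian m S) ⟨inferInstance, by
      rw [wassersteinDist_self h0 (measurable_ellipsoidalNorm_sub S)]
      exact zero_le⟩
    simp only [hlu] at h1
    have h2 : 0 < ENNReal.ofReal (1 - ε) := ENNReal.ofReal_pos.2 (by linarith)
    simp at h1
    linarith
  · intro h Q hQ
    have := hQ.1
    simp [h]
    linarith

end

/-! ### The closed conic hull -/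

theorem neg_and_pos_of_mem_standardSet {δ ε : ℝ} (hδ : 0 < δ) (hε : ε < 1 / 2) {z : ℝ × ℝ}
    (hz : z ∈ standardSet δ ε) : z.1 < 0 ∧ 0 < z.2 := by
  rw [mem_standardSet_iff hδ (by linarith)] at hz
  have h := pos_of_excess_pos hε (excess_zero_pos (hδ.trans_le hz))
  constructor <;> linarith [h.1, h.2]

theorem standardSet_mono {δ ε ℓ u ℓ' u' : ℝ} (h : (ℓ, u) ∈ standardSet δ ε) (hℓ : ℓ' ≤ ℓ)
    (hu : u ≤ u') : (ℓ', u') ∈ standardSet δ ε :=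
  mem_standardSet.2 fun Q hQ =>
    (mem_standardSet.1 h Q hQ).trans (measure_mono (Icc_subset_Icc hℓ hu))

theorem standardSet_nonempty {δ ε : ℝ} (hδ : 0 < δ) (hε₀ : 0 < ε) (hε : ε < 1) :
    (standardSet δ ε).Nonempty := by
  obtain ⟨R, hR⟩ := (tendsto_stdNormalCDF_atTop.eventually_const_lt
    (by linarith : 1 - ε / 4 < 1)).exists
  -- On `(0, 2 δ / ε]` the integrand of `g_ε` is at least `ε / 2`.
  refine ⟨(-(R + 2 * δ / ε), R + 2 * δ / ε), (mem_standardSet_iff hδ hε _).2 ?_⟩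
  refine (ENNReal.ofReal_le_ofReal_iff (gFun_nonneg _ _ _)).1 ?_
  rw [ofReal_gFun hε]
  calc ENNReal.ofReal δ = ENNReal.ofReal (ε / 2) * volume (Ioc 0 (2 * δ / ε)) := by
        rw [Real.volume_Ioc, sub_zero, ← ENNReal.ofReal_mul (by linarith)]
        congr 1
        field_simp
    _ = ∫⁻ _ in Ioc 0 (2 * δ / ε), ENNReal.ofReal (ε / 2) := (setLIntegral_const _ _).symm
    _ ≤ ∫⁻ t in Ioc 0 (2 * δ / ε), ENNReal.ofReal
          (centralProb (-(R + 2 * δ / ε)) (R + 2 * δ / ε) t - (1 - ε)) := by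
        refine setLIntegral_mono' measurableSet_Ioc fun t ht => ENNReal.ofReal_le_ofReal ?_
        have h1 := stdNormalCDF_mono (show R ≤ R + 2 * δ / ε - t by linarith [ht.2])
        have h2 := stdNormalCDF_neg (R + 2 * δ / ε - t)
        rw [centralProb, show -(R + 2 * δ / ε) + t = -(R + 2 * δ / ε - t) by ring, h2]
        linarith
    _ ≤ _ := lintegral_mono_set Ioc_subset_Ioi_self

theorem mem_conicHull_of_pos {δ ε l u s : ℝ} (hs : 0 < s) :
    (l, u, s) ∈ conicHull δ ε ↔ (l / s, u / s) ∈ standardSet δ ε := by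
  refine ⟨fun h => ?_, fun h => subset_closure ⟨hs, h⟩⟩
  have hf : ContinuousAt (fun z : ℝ × ℝ × ℝ => (z.1 / z.2.2, z.2.1 / z.2.2)) (l, u, s) :=
    ContinuousAt.prodMk (continuousAt_fst.div continuousAt_snd.snd hs.ne')
      (continuousAt_snd.fst.div continuousAt_snd.snd hs.ne')
  have h1 := mem_closure_image hf h
  refine closure_minimal ?_ (isClosed_standardSet δ ε) h1
  rintro _ ⟨z, hz, rfl⟩
  exact hz.2

theorem nonpos_and_nonneg_of_mem_conicHull {δ ε : ℝ} (hδ : 0 < δ) (hε : ε < 1 / 2)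
    {z : ℝ × ℝ × ℝ} (hz : z ∈ conicHull δ ε) : z.1 ≤ 0 ∧ 0 ≤ z.2.1 := by
  refine closure_minimal (t := {z : ℝ × ℝ × ℝ | z.1 ≤ 0 ∧ 0 ≤ z.2.1}) (fun w hw => ?_)
    ((isClosed_le continuous_fst continuous_const).inter
      (isClosed_le continuous_const continuous_snd.fst)) hz
  have h := neg_and_pos_of_mem_standardSet hδ hε hw.2
  have h1 := (div_lt_iff₀ hw.1).1 h.1
  have h2 := (lt_div_iff₀ hw.1).1 h.2
  rw [zero_mul] at h1 h2
  exact ⟨h1.le, h2.le⟩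

theorem mem_conicHull_zero {δ ε l u : ℝ} (hδ : 0 < δ) (hε₀ : 0 < ε) (hε : ε < 1)
    (hl : l ≤ 0) (hu : 0 ≤ u) : (l, u, 0) ∈ conicHull δ ε := by
  obtain ⟨⟨a, b⟩, hab⟩ := standardSet_nonempty hδ hε₀ hε
  have hlim : Tendsto (fun s : ℝ => (l + s * a, u + s * b, s)) (𝓝[>] 0) (𝓝 (l, u, 0)) := by
    have hc : Continuous fun s : ℝ => (l + s * a, u + s * b, s) := by fun_prop
    refine (hc.tendsto' 0 _ ?_).mono_left nhdsWithin_le_nhds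
    simp
  refine mem_closure_of_tendsto hlim ?_
  filter_upwards [self_mem_nhdsWithin] with s (hs : 0 < s)
  refine ⟨hs, standardSet_mono hab ?_ ?_⟩
  · exact (div_le_iff₀ hs).2 (by linarith)
  · exact (le_div_iff₀ hs).2 (by linarith)

/-- As the sections of the cone contain `(ℓ, u)` only if `ℓ ≤ 0 ≤ u`, they grow as the scale
decreases. -/
theorem conicHull_anti {δ ε l u r s : ℝ} (hδ : 0 < δ) (hε : ε < 1 / 2) (hr : 0 < r) (hrs : r ≤ s)
    (h : (l, u, s) ∈ conicHull δ ε) : (l, u, r) ∈ conicHull δ ε := by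
  have hs : 0 < s := hr.trans_le hrs
  obtain ⟨hl, hu⟩ := nonpos_and_nonneg_of_mem_conicHull hδ hε h
  rw [mem_conicHull_of_pos hr]
  refine standardSet_mono ((mem_conicHull_of_pos hs).1 h) ?_ (div_le_div_of_nonneg_left hu hr hrs)
  have := div_le_div_of_nonneg_left (neg_nonneg.2 hl) hr hrs
  rw [neg_div, neg_div] at this
  exact neg_le_neg_iff.1 this

theorem convex_conicHull {δ ε : ℝ} (hδ : 0 < δ) (hε : ε < 1 / 2) : Convex ℝ (conicHull δ ε) := by
  refine Convex.closure ?_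
  rintro ⟨l₁, u₁, s₁⟩ ⟨hs₁, hz⟩ ⟨l₂, u₂, s₂⟩ ⟨hs₂, hw⟩ a b ha hb hab
  dsimp only at hs₁ hs₂ hz hw
  have hs : 0 < a * s₁ + b * s₂ := convex_Ioi (0 : ℝ) hs₁ hs₂ ha hb hab
  refine ⟨hs, ?_⟩
  have h := convex_standardSet hδ hε hz hw (div_nonneg (mul_nonneg ha hs₁.le) hs.le)
    (div_nonneg (mul_nonneg hb hs₂.le) hs.le) (by rw [← add_div, div_self hs.ne'])
  convert h using 1
  ext
  · simp only [Prod.smul_mk, Prod.mk_add_mk, smul_eq_mul]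
    field_simp
  · simp only [Prod.smul_mk, Prod.mk_add_mk, smul_eq_mul]
    field_simp

/-! ### The feasible set -/

theorem mem_feasibleSet_iff {n : ℕ} (m : EuclideanSpace ℝ (Fin n))
    {S : Matrix (Fin n) (Fin n) ℝ} (hS : S.PosDef) {δ ε : ℝ} (hδ : 0 < δ) (hε₀ : 0 < ε)
    (hε : ε < 1 / 2) (x : EuclideanSpace ℝ (Fin n)) (l u : ℝ) :
    (x, l, u) ∈ feasibleSet m S δ ε ↔ ∃ s : ℝ, dualNorm (ellipsoidalNorm S) x ≤ s ∧
      (l - inner ℝ x m, u - inner ℝ x m, s) ∈ conicHull δ ε := by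
  rw [dualNorm_eq hS]
  rcases eq_or_ne x 0 with rfl | hx
  · rw [mem_feasibleSet_zero hε₀ (by linarith), map_zero, norm_zero, inner_zero_left, sub_zero,
      sub_zero]
    exact ⟨fun h => ⟨0, le_rfl, mem_conicHull_zero hδ hε₀ (by linarith) h.1 h.2⟩,
      fun ⟨s, _, h⟩ => nonpos_and_nonneg_of_mem_conicHull hδ hε h⟩
  · have hσ : 0 < ‖sqrtOp S x‖ :=
      lt_of_le_of_ne (norm_nonneg _) fun h => hx ((norm_sqrtOp_eq_zero hS).1 h.symm)
    rw [mem_feasibleSet_iff_of_ne_zero hS hδ (by linarith) hx, ← mem_conicHull_of_pos hσ]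
    exact ⟨fun h => ⟨_, le_rfl, h⟩, fun ⟨s, hs, h⟩ => conicHull_anti hδ hε hσ hs h⟩

theorem convex_feasibleSet {n : ℕ} (m : EuclideanSpace ℝ (Fin n))
    {S : Matrix (Fin n) (Fin n) ℝ} (hS : S.PosDef) {δ ε : ℝ} (hδ : 0 < δ) (hε₀ : 0 < ε)
    (hε : ε < 1 / 2) : Convex ℝ (feasibleSet m S δ ε) := by
  rintro ⟨x, l₁, u₁⟩ hz ⟨y, l₂, u₂⟩ hw a b ha hb hab
  simp only [Prod.smul_mk, Prod.mk_add_mk, smul_eq_mul]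
  rw [mem_feasibleSet_iff m hS hδ hε₀ hε, dualNorm_eq hS] at *
  obtain ⟨s, hs, hzs⟩ := hz
  obtain ⟨t, ht, hwt⟩ := hw
  refine ⟨a * s + b * t, ?_, ?_⟩
  · rw [map_add, map_smul, map_smul]
    refine (norm_add_le _ _).trans ?_
    rw [norm_smul, norm_smul, Real.norm_of_nonneg ha, Real.norm_of_nonneg hb]
    gcongr
  · convert convex_conicHull hδ hε hzs hwt ha hb hab using 1
    simp only [Prod.smul_mk, Prod.mk_add_mk, smul_eq_mul, inner_add_left, real_inner_smul_left]
    ext <;> dsimp only <;> ring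

theorem isClosed_feasibleSet {n : ℕ} (m : EuclideanSpace ℝ (Fin n))
    (S : Matrix (Fin n) (Fin n) ℝ) (δ ε : ℝ) : IsClosed (feasibleSet m S δ ε) := by
  have h : feasibleSet m S δ ε =
      ⋂ Q ∈ wassersteinBall (ellipsoidalNorm S) (multivariateGaussian m S) δ,
        {z | ENNReal.ofReal (1 - ε) ≤
          Q {ξ | z.2.1 ≤ inner ℝ z.1 ξ ∧ inner ℝ z.1 ξ ≤ z.2.2}} := by
    ext z
    rw [mem_feasibleSet, mem_iInter₂]
    rfl
  rw [h]
  refine isClosed_biInter fun Q hQ => ?_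
  have := hQ.1
  refine isClosed_setOf_le_measure (F := fun z : EuclideanSpace ℝ (Fin n) × ℝ × ℝ =>
    {ξ | z.2.1 ≤ inner ℝ z.1 ξ ∧ inner ℝ z.1 ξ ≤ z.2.2}) Q (fun z => ?_) (fun ξ => ?_) _
  · have hf : Measurable fun ξ : EuclideanSpace ℝ (Fin n) => inner ℝ z.1 ξ := by fun_prop
    exact hf measurableSet_Icc
  · have hf : Continuous fun z : EuclideanSpace ℝ (Fin n) × ℝ × ℝ => inner ℝ z.1 ξ := by fun_prop
    exact (isClosed_le continuous_snd.fst hf).inter (isClosed_le hf continuous_snd.snd)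

end WassersteinCC

theorem mainTheorem1 (n : ℕ) (m : EuclideanSpace ℝ (Fin n)) (S : Matrix (Fin n) (Fin n) ℝ)
    (hS : S.PosDef) (δ ε : ℝ) (hδ : 0 < δ) (hε₀ : 0 < ε) (hε₁ : ε < 1 / 2) :
    WassersteinCC.standardSet δ ε = {z : ℝ × ℝ | δ ≤ WassersteinCC.gFun ε z.1 z.2} ∧
    (∀ (x : EuclideanSpace ℝ (Fin n)) (l u : ℝ),
      (x, l, u) ∈ WassersteinCC.feasibleSet m S δ ε ↔
        ∃ s : ℝ, WassersteinCC.dualNorm (WassersteinCC.ellipsoidalNorm S) x ≤ s ∧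
          (l - inner ℝ x m, u - inner ℝ x m, s) ∈ WassersteinCC.conicHull δ ε) ∧
    Convex ℝ (WassersteinCC.standardSet δ ε) ∧ IsClosed (WassersteinCC.standardSet δ ε) ∧
    Convex ℝ (WassersteinCC.feasibleSet m S δ ε) ∧
    IsClosed (WassersteinCC.feasibleSet m S δ ε) := by
  have hε : ε < 1 := by linarith
  refine ⟨?_, fun x l u => WassersteinCC.mem_feasibleSet_iff m hS hδ hε₀ hε₁ x l u,
    WassersteinCC.convex_standardSet hδ hε₁, WassersteinCC.isClosed_standardSet δ ε,
    WassersteinCC.convex_feasibleSet m hS hδ hε₀ hε₁, WassersteinCC.isClosed_feasibleSet m S δ ε⟩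
  ext z
  exact WassersteinCC.mem_standardSet_iff hδ hε z
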